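/- **Theorem 1.1.** Let $R$ be a commutative ring and let $\mathcal{C}$ be a category. A *cohomology* on $\mathcal{C}$ with values in an abelian category $\mathcal{A}$ is a family $H=\{H^i\}_{i\in\mathbb{N}}$ of contravariant functors $H^i:\mathcal{C}\to\mathcal{A}$; morphisms are families of natural transformations. Its push-forward along an exact functor $G:\mathcal{A}\to\mathcal{B}$ is $G_*H=\{G\circ H^i\}_{i\in\mathbb{N}}$. (1) There are an $R$-linear abelian category $\mathcal{A}(\mathcal{C})$ and a cohomology $U$ on $\mathcal{C}$ with values in $\mathcal{A}(\mathcal{C})$ such that, for every $R$-linear abelian category $\mathcal{B}$, the functor $F\mapsto F_*U$ is an equivalence from the category of exact $R$-linear functors $\mathcal{A}(\mathcal{C})\to\mathcal{B}$ (and all natural transformations) to the category of cohomologies on $\mathcal{C}$ with values in $\mathcal{B}$. In particular, every cohomology $H$ with values in $\mathcal{B}$ is isomorphic to $(F_H)_*U$ for an exact $R$-linear functor $F_H:\mathcal{A}(\mathcal{C})\to\mathcal{B}$ that is unique up to isomorphism. Moreover, $\mathcal{A}(\mathcal{C})$, with the functor $\mathcal{C}^{\mathrm{op}}\times\mathbb{N}\to\mathcal{A}(\mathcal{C})$,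 $(X,i)\mapsto U^i(X)$ ($\mathbb{N}$ being a discrete category), is the free $R$-linear abelian category on $\mathcal{C}^{\mathrm{op}}\times\mathbb{N}$: for every $R$-linear abelian category $\mathcal{B}$, restriction along this functor is an equivalence from the category of exact $R$-linear functors $\mathcal{A}(\mathcal{C})\to\mathcal{B}$ to the category of all functors $\mathcal{C}^{\mathrm{op}}\times\mathbb{N}\to\mathcal{B}$. (2) Let $\mathcal{M}$ be a class of arrows of $\mathcal{C}$ closed under composition, for example the arrows of a distinguished subcategory. Let $\mathcal{C}^\square$ be the category whose objects are the *pairs* $(X,Y)$, given by an arrow $Y\to X$ in $\mathcal{M}$, and whose morphisms are the commutative squares of $\mathcal{C}$. A *triple* $(X,Y,Z)$ is a chain $Z\to Y\to X$ of arrows in $\mathcal{M}$; morphisms of triples are commutative diagrams in $\mathcal{C}$. A *relative cohomology* on $\mathcal{C}^\square$ with values in an abelian category $\mathcal{A}$ is a family of contravariant functors $H^i:\mathcal{C}^\square\to\mathcal{A}$, $i\in\mathbb{N}$, with boundary morphisms $\partial^i:H^i(Y,Z)\to H^{i+1}(X,Y)$ for all triples $(X,Y,Z)$, natural in the triple, such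 that for every triple the sequence $$0\to H^0(X,Y)\to H^0(X,Z)\to H^0(Y,Z)\xrightarrow{\partial^0}H^1(X,Y)\to H^1(X,Z)\to H^1(Y,Z)\xrightarrow{\partial^1}\cdots$$ is exact. Morphisms are families of natural transformations commuting with the boundaries, and the push-forward along an exact functor is defined by applying that functor to the $H^i$ and the $\partial^i$. Then there are an $R$-linear abelian category $\mathcal{A}_\partial(\mathcal{C})$ and a relative cohomology $U_\partial$ on $\mathcal{C}^\square$ with values in $\mathcal{A}_\partial(\mathcal{C})$ such that, for every $R$-linear abelian category $\mathcal{B}$, the functor $F\mapsto F_*U_\partial$ is an equivalence from the category of exact $R$-linear functors $\mathcal{A}_\partial(\mathcal{C})\to\mathcal{B}$ to the category of relative cohomologies on $\mathcal{C}^\square$ with values in $\mathcal{B}$. -/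

import Mathlib

open CategoryTheory CategoryTheory.Limits Opposite

/-! ### Exact `R`-linear functors between `R`-linear abelian categories -/

/-- The property of a functor between `R`-linear abelian categories of being exact and
`R`-linear. -/
def isExactLinear.{w, a, b, t, s} (R : Type w) [CommRing R]
    (A : Type a) [Category.{b} A] [Abelian A] [Linear R A]
    (B : Type t) [Category.{s} B] [Abelian B] [Linear R B] : ObjectProperty (A ⥤ B) :=
  fun F => F.Additive ∧ F.Linear R ∧
    PreservesFiniteLimits F ∧ PreservesFiniteColimits F

/-- The category of exact `R`-linear functors `A ⥤ B`, the morphisms being all natural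
transformations. -/
abbrev ExactLinearFunctor.{w, a, b, t, s} (R : Type w) [CommRing R]
    (A : Type a) [Category.{b} A] [Abelian A] [Linear R A]
    (B : Type t) [Category.{s} B] [Abelian B] [Linear R B] :=
  (isExactLinear R A B).FullSubcategory

/-! ### Free abelian categories -/

/-- Restriction of exact `R`-linear functors `A ⥤ B` along a functor `j : D ⥤ A`. -/
def restrictAlong.{w, d, e, a, b, t, s} (R : Type w) [CommRing R]
    {D : Type d} [Category.{e} D]
    {A : Type a} [Category.{b} A] [Abelian A] [Linear R A] (j : D ⥤ A)
    (B : Type t) [Category.{s} B] [Abelian B] [Linear R B] :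
    ExactLinearFunctor R A B ⥤ (D ⥤ B) :=
  (isExactLinear R A B).ι ⋙ (Functor.whiskeringLeft D A B).obj j

/-- `j : D ⥤ A` exhibits `A` as the free `R`-linear abelian category on the category `D`: for
every `R`-linear abelian category `B`, restriction along `j` is an equivalence between the
category of exact `R`-linear functors `A ⥤ B` and the category of all functors `D ⥤ B`.
The category `B` ranges over `Type t` with morphisms in `Type s`. -/
def IsFreeAbelian.{w, d, e, a, b, t, s} (R : Type w) [CommRing R]
    {D : Type d} [Category.{e} D]
    {A : Type a} [Category.{b} A] [Abelian A] [Linear R A] (j : D ⥤ A) : Prop :=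
  ∀ (B : Type t) [Category.{s} B] [Abelian B] [Linear R B],
    (restrictAlong R j B).IsEquivalence

/-! ### Cohomologies -/

/-- A cohomology on `C` with values in `A` is a family, indexed by `ℕ`, of contravariant
functors from `C` to `A`.  Morphisms are families of natural transformations. -/
abbrev Cohomology.{u, v, a, b} (C : Type u) [Category.{v} C] (A : Type a) [Category.{b} A] :=
  ℕ → (Cᵒᵖ ⥤ A)

/-- A cohomology, seen as one functor on `Cᵒᵖ × ℕ`, where `ℕ` is a discrete category. -/
def Cohomology.toFunctor.{u, v, a, b} {C : Type u} [Category.{v} C]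
    {A : Type a} [Category.{b} A] (H : Cohomology C A) : Cᵒᵖ × Discrete ℕ ⥤ A :=
  CategoryTheory.Prod.swap Cᵒᵖ (Discrete ℕ) ⋙ Functor.uncurry.obj (Discrete.functor H)

/-- The push-forward `G_* H` of a cohomology along a functor, given by `(G_* H)^i = G ∘ H^i`. -/
abbrev Cohomology.pushforward.{u, v, a, b, t, s} {C : Type u} [Category.{v} C]
    {A : Type a} [Category.{b} A] {B : Type t} [Category.{s} B]
    (H : Cohomology C A) (G : A ⥤ B) : Cohomology C B :=
  fun i => H i ⋙ G

/-- Push-forward of a fixed cohomology with values in `A`, as a functor of the exact `R`-linear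
functor `A ⥤ B` along which it is formed. -/
def Cohomology.pushforwardFunctor.{w, u, v, a, b, t, s} (R : Type w) [CommRing R]
    {C : Type u} [Category.{v} C]
    {A : Type a} [Category.{b} A] [Abelian A] [Linear R A] (U : Cohomology C A)
    (B : Type t) [Category.{s} B] [Abelian B] [Linear R B] :
    ExactLinearFunctor R A B ⥤ Cohomology C B where
  obj G := U.pushforward G.obj
  map φ := fun i => Functor.whiskerLeft (U i) φ.hom

/-- A cohomology `U` with values in an `R`-linear abelian category `A` is universal if it
represents the 2-functor of cohomologies: for every `R`-linear abelian category `B`, push-forward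
of `U` is an equivalence between the category of exact `R`-linear functors `A ⥤ B` and the
category of cohomologies on `C` with values in `B`. -/
def Cohomology.IsUniversal.{w, u, v, a, b, t, s} (R : Type w) [CommRing R]
    {C : Type u} [Category.{v} C]
    {A : Type a} [Category.{b} A] [Abelian A] [Linear R A] (U : Cohomology C A) : Prop :=
  ∀ (B : Type t) [Category.{s} B] [Abelian B] [Linear R B],
    (U.pushforwardFunctor R B).IsEquivalence

/-! ### Pairs, triples and relative cohomologies -/

/-- The category of pairs attached to a class `M` of distinguished arrows of `C`.  Its objects
are the arrows `Y ⟶ X` in `M`, thought of as pairs `(X, Y)`, and its morphisms are all the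
commutative squares of `C` between them. -/
abbrev Pairs.{u, v} {C : Type u} [Category.{v} C] (M : MorphismProperty C) :=
  ObjectProperty.FullSubcategory (fun p : Arrow C => M p.hom)

/-- The pair `(X, Y)` given by an arrow `f : Y ⟶ X` in `M`. -/
def Pairs.of.{u, v} {C : Type u} [Category.{v} C] {M : MorphismProperty C} {X Y : C}
    (f : Y ⟶ X) (hf : M f) : Pairs M :=
  ⟨Arrow.mk f, hf⟩

/-- The morphism of pairs `(X, Y) ⟶ (X', Y')` given by a commutative square. -/
def Pairs.ofHom.{u, v} {C : Type u} [Category.{v} C] {M : MorphismProperty C} {X Y X' Y' : C}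
    {f : Y ⟶ X} {hf : M f} {f' : Y' ⟶ X'} {hf' : M f'} (y : Y ⟶ Y') (x : X ⟶ X')
    (w : y ≫ f' = f ≫ x) : Pairs.of f hf ⟶ Pairs.of f' hf' :=
  ObjectProperty.homMk (Arrow.homMk y x w)

/-- A triple `(X, Y, Z)`: two composable arrows `Z ⟶ Y ⟶ X` in `M`. -/
structure PairTriple.{u, v} {C : Type u} [Category.{v} C] (M : MorphismProperty C) where
  (X Y Z : C)
  f : Y ⟶ X
  g : Z ⟶ Y
  hf : M f
  hg : M g

namespace PairTriple

/-- A morphism of triples: three arrows of `C` making the two evident squares commute. -/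
structure Hom.{u, v} {C : Type u} [Category.{v} C] {M : MorphismProperty C}
    (T T' : PairTriple M) where
  x : T.X ⟶ T'.X
  y : T.Y ⟶ T'.Y
  z : T.Z ⟶ T'.Z
  commf : y ≫ T'.f = T.f ≫ x
  commg : z ≫ T'.g = T.g ≫ y

universe u v

variable {C : Type u} [Category.{v} C] {M : MorphismProperty C}

/-- The pair `(X, Y)` of a triple. -/
def pairXY (T : PairTriple M) : Pairs M := Pairs.of T.f T.hf

/-- The pair `(Y, Z)` of a triple. -/
def pairYZ (T : PairTriple M) : Pairs M := Pairs.of T.g T.hg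

/-- The pair `(X, Z)` of a triple. -/
def pairXZ [M.IsStableUnderComposition] (T : PairTriple M) : Pairs M :=
  Pairs.of (T.g ≫ T.f) (M.comp_mem _ _ T.hg T.hf)

/-- The inclusion `(Y, Z) ⟶ (X, Z)`. -/
def incl [M.IsStableUnderComposition] (T : PairTriple M) : T.pairYZ ⟶ T.pairXZ :=
  Pairs.ofHom (𝟙 T.Z) T.f (Category.id_comp _)

/-- The projection `(X, Z) ⟶ (X, Y)`. -/
def proj [M.IsStableUnderComposition] (T : PairTriple M) : T.pairXZ ⟶ T.pairXY :=
  Pairs.ofHom T.g (𝟙 T.X) (Category.comp_id _).symm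

/-- The morphism `(X, Y) ⟶ (X', Y')` induced by a morphism of triples. -/
def Hom.xy {T T' : PairTriple M} (φ : T.Hom T') : T.pairXY ⟶ T'.pairXY :=
  Pairs.ofHom φ.y φ.x φ.commf

/-- The morphism `(Y, Z) ⟶ (Y', Z')` induced by a morphism of triples. -/
def Hom.yz {T T' : PairTriple M} (φ : T.Hom T') : T.pairYZ ⟶ T'.pairYZ :=
  Pairs.ofHom φ.z φ.y φ.commg

end PairTriple

/-- Exactness at the middle term of two composable arrows: their composite vanishes and the
resulting complex is exact. -/
def ExactAt.{a, b} {A : Type a} [Category.{b} A] [Abelian A] {P Q S : A}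
    (f : P ⟶ Q) (g : Q ⟶ S) : Prop :=
  ∃ w : f ≫ g = 0, (ShortComplex.mk f g w).Exact

theorem ExactAt.map.{a, b, t, s} {A : Type a} [Category.{b} A] [Abelian A]
    {B : Type t} [Category.{s} B] [Abelian B] {P Q S : A}
    {f : P ⟶ Q} {g : Q ⟶ S} (h : ExactAt f g) (G : A ⥤ B) [G.Additive]
    [PreservesFiniteLimits G] [PreservesFiniteColimits G] : ExactAt (G.map f) (G.map g) := by
  obtain ⟨w, h⟩ := h
  exact ⟨by rw [← G.map_comp, w, G.map_zero], h.map G⟩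

/-- A relative cohomology on the category of pairs of `M`, with values in an abelian category `A`:
contravariant functors `H^i` (`i : ℕ`) on pairs and, for every triple `(X, Y, Z)`, boundary
morphisms `H^i(Y, Z) ⟶ H^{i+1}(X, Y)` natural in the triple, such that
`0 ⟶ H^0(X, Y) ⟶ H^0(X, Z) ⟶ H^0(Y, Z) ⟶ H^1(X, Y) ⟶ H^1(X, Z) ⟶ ⋯` is exact. -/
structure RelCohomology.{u, v, a, b} {C : Type u} [Category.{v} C] (M : MorphismProperty C)
    [M.IsStableUnderComposition] (A : Type a) [Category.{b} A] [Abelian A] where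
  H : ℕ → ((Pairs M)ᵒᵖ ⥤ A)
  δ : ∀ (i : ℕ) (T : PairTriple M), (H i).obj (op T.pairYZ) ⟶ (H (i + 1)).obj (op T.pairXY)
  naturality : ∀ (i : ℕ) {T T' : PairTriple M} (φ : T.Hom T'),
    (H i).map φ.yz.op ≫ δ i T = δ i T' ≫ (H (i + 1)).map φ.xy.op
  mono_zero : ∀ T : PairTriple M, Mono ((H 0).map T.proj.op)
  exact_xz : ∀ (i : ℕ) (T : PairTriple M), ExactAt ((H i).map T.proj.op) ((H i).map T.incl.op)
  exact_yz : ∀ (i : ℕ) (T : PairTriple M), ExactAt ((H i).map T.incl.op) (δ i T)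
  exact_xy : ∀ (i : ℕ) (T : PairTriple M), ExactAt (δ i T) ((H (i + 1)).map T.proj.op)

namespace RelCohomology

universe w u v a b t s

variable {C : Type u} [Category.{v} C] {M : MorphismProperty C} [M.IsStableUnderComposition]
  {A : Type a} [Category.{b} A] [Abelian A]

/-- A morphism of relative cohomologies: natural transformations in all degrees that commute with
the boundary morphisms. -/
@[ext]
structure Hom (K L : RelCohomology M A) where
  app : ∀ i : ℕ, K.H i ⟶ L.H i
  comm : ∀ (i : ℕ) (T : PairTriple M),
    (app i).app (op T.pairYZ) ≫ L.δ i T = K.δ i T ≫ (app (i + 1)).app (op T.pairXY)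

instance : Category (RelCohomology M A) where
  Hom := Hom
  id K := { app := fun i => 𝟙 (K.H i), comm := by intros; simp }
  comp φ ψ :=
    { app := fun i => φ.app i ≫ ψ.app i
      comm := by
        intro i T
        simp only [NatTrans.comp_app, Category.assoc]
        rw [ψ.comm, ← Category.assoc, φ.comm, Category.assoc] }
  id_comp φ := by apply Hom.ext; funext i; exact Category.id_comp _
  comp_id φ := by apply Hom.ext; funext i; exact Category.comp_id _
  assoc φ ψ χ := by apply Hom.ext; funext i; exact Category.assoc _ _ _

/-- The push-forward `G_* K` of a relative cohomology along an exact functor `G`: the functors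
are `G ∘ K^i` and the boundary morphisms are the images of those of `K`. -/
def pushforward {B : Type t} [Category.{s} B] [Abelian B] (K : RelCohomology M A) (G : A ⥤ B)
    [G.Additive] [PreservesFiniteLimits G] [PreservesFiniteColimits G] : RelCohomology M B where
  H i := K.H i ⋙ G
  δ i T := G.map (K.δ i T)
  naturality i T T' φ := by
    simp only [Functor.comp_map, ← G.map_comp, K.naturality]
  mono_zero T := by
    have := K.mono_zero T
    exact inferInstanceAs (Mono (G.map ((K.H 0).map T.proj.op)))
  exact_xz i T := (K.exact_xz i T).map G
  exact_yz i T := (K.exact_yz i T).map G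
  exact_xy i T := (K.exact_xy i T).map G

/-- Push-forward of a fixed relative cohomology with values in `A`, as a functor of the exact
`R`-linear functor `A ⥤ B` along which it is formed. -/
def pushforwardFunctor (R : Type w) [CommRing R] [Linear R A] (U : RelCohomology M A)
    (B : Type t) [Category.{s} B] [Abelian B] [Linear R B] :
    ExactLinearFunctor R A B ⥤ RelCohomology M B where
  obj G :=
    haveI := G.property.1
    haveI := G.property.2.2.1
    haveI := G.property.2.2.2
    U.pushforward G.obj
  map φ :=
    { app := fun i => Functor.whiskerLeft (U.H i) φ.hom
      comm := fun i T => (φ.hom.naturality (U.δ i T)).symm }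
  map_id _ := rfl
  map_comp _ _ := rfl

end RelCohomology

/-- A relative cohomology `U` with values in an `R`-linear abelian category `A` is universal if it
represents the 2-functor of relative cohomologies: for every `R`-linear abelian category `B`,
push-forward of `U` is an equivalence between the category of exact `R`-linear functors `A ⥤ B`
and the category of relative cohomologies with values in `B`. -/
def RelCohomology.IsUniversal.{w, u, v, a, b, t, s} (R : Type w) [CommRing R]
    {C : Type u} [Category.{v} C] {M : MorphismProperty C} [M.IsStableUnderComposition]
    {A : Type a} [Category.{b} A] [Abelian A] [Linear R A] (U : RelCohomology M A) : Prop :=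
  ∀ (B : Type t) [Category.{s} B] [Abelian B] [Linear R B],
    (U.pushforwardFunctor R B).IsEquivalence

universe w u v t s

universe p q z a b t' s'

/-! ### Terms for objects and morphisms of an abelian category -/


mutual

/-- Terms for the objects of an `R`-linear abelian category generated by a quiver `Q`. -/
inductive ObjTerm (R : Type w) (Q : Type q) [Quiver.{p} Q] : Type (max p q w)
  | gen (x : Q)
  | zero
  | biprod (a b : ObjTerm R Q)
  | ker (a b : ObjTerm R Q) (e : MorTerm R Q)
  | coker (a b : ObjTerm R Q) (e : MorTerm R Q)

/-- Terms for the morphisms of an `R`-linear abelian category generated by a quiver `Q`.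
The term `lift b e k` stands for a factorization of `k` through the monomorphism `e` with
target `b`, and `desc a e k` for a factorization of `k` through the epimorphism `e` with
source `a`. -/
inductive MorTerm (R : Type w) (Q : Type q) [Quiver.{p} Q] : Type (max p q w)
  | gen {x y : Q} (f : x ⟶ y)
  | id
  | zero
  | add (e k : MorTerm R Q)
  | smul (r : R) (e : MorTerm R Q)
  | comp (b : ObjTerm R Q) (e k : MorTerm R Q)
  | inl (a b : ObjTerm R Q)
  | inr (a b : ObjTerm R Q)
  | fst (a b : ObjTerm R Q)
  | snd (a b : ObjTerm R Q)
  | ker (a b : ObjTerm R Q) (e : MorTerm R Q)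
  | coker (a b : ObjTerm R Q) (e : MorTerm R Q)
  | lift (b : ObjTerm R Q) (e k : MorTerm R Q)
  | desc (a : ObjTerm R Q) (e k : MorTerm R Q)

end

open Classical in
/-- A morphism, regarded as a morphism between objects that are supposed to be equal to its
source and its target; the zero morphism if they are not. -/
noncomputable def retype {B : Type t} [Category.{s} B] [HasZeroMorphisms B] {X Y : B}
    (f : X ⟶ Y) (X' Y' : B) : X' ⟶ Y' :=
  if h : X' = X ∧ Y = Y' then eqToHom h.1 ≫ f ≫ eqToHom h.2 else 0

@[simp]
lemma retype_self {B : Type t} [Category.{s} B] [HasZeroMorphisms B] {X Y : B} (f : X ⟶ Y) :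
    retype f X Y = f := by
  simp [retype]

open Classical in
/-- A factorization of `k` through `e` on the right, or zero if there is none. -/
noncomputable def factorRight {B : Type t} [Category.{s} B] [HasZeroMorphisms B] {X Y Z : B}
    (e : Y ⟶ Z) (k : X ⟶ Z) : X ⟶ Y :=
  if h : ∃ l : X ⟶ Y, l ≫ e = k then h.choose else 0

lemma factorRight_comp {B : Type t} [Category.{s} B] [HasZeroMorphisms B] {X Y Z : B}
    {e : Y ⟶ Z} {k : X ⟶ Z} (h : ∃ l : X ⟶ Y, l ≫ e = k) : factorRight e k ≫ e = k := by
  rw [factorRight, dif_pos h]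
  exact h.choose_spec

open Classical in
/-- A factorization of `k` through `e` on the left, or zero if there is none. -/
noncomputable def factorLeft {B : Type t} [Category.{s} B] [HasZeroMorphisms B] {X Y Z : B}
    (e : X ⟶ Y) (k : X ⟶ Z) : Y ⟶ Z :=
  if h : ∃ l : Y ⟶ Z, e ≫ l = k then h.choose else 0

lemma comp_factorLeft {B : Type t} [Category.{s} B] [HasZeroMorphisms B] {X Y Z : B}
    {e : X ⟶ Y} {k : X ⟶ Z} (h : ∃ l : Y ⟶ Z, e ≫ l = k) : e ≫ factorLeft e k = k := by
  rw [factorLeft, dif_pos h]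
  exact h.choose_spec

section Eval

variable {R : Type w} [CommRing R] {Q : Type q} [Quiver.{p} Q]
  {B : Type t} [Category.{s} B] [Abelian B] [Linear R B]

mutual

/-- The object of `B` that a term denotes, given a diagram of shape `Q` in `B`. It is lifted to
the universe of the values of `MorTerm.eval`, as the mutual recursion requires. -/
noncomputable def ObjTerm.evalULift (H : Q ⥤q B) : ObjTerm R Q → ULift.{s} B
  | .gen x => ⟨H.obj x⟩
  | .zero => ⟨HasZeroObject.zero' B |>.zero⟩
  | .biprod a b => ⟨(a.evalULift H).down ⊞ (b.evalULift H).down⟩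
  | .ker a b e => ⟨kernel (e.eval H (a.evalULift H).down (b.evalULift H).down)⟩
  | .coker a b e => ⟨cokernel (e.eval H (a.evalULift H).down (b.evalULift H).down)⟩

/-- The morphism of `B` that a term denotes when it is read as a morphism between two given
objects, given a diagram of shape `Q` in `B`. -/
noncomputable def MorTerm.eval (H : Q ⥤q B) : MorTerm R Q → ∀ X Y : B, X ⟶ Y
  | .gen f => fun X Y => retype (H.map f) X Y
  | .id => fun X Y => retype (𝟙 X) X Y
  | .zero => fun _ _ => 0
  | .add e k => fun X Y => e.eval H X Y + k.eval H X Y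
  | .smul r e => fun X Y => r • e.eval H X Y
  | .comp b e k => fun X Y =>
      e.eval H X (b.evalULift H).down ≫ k.eval H (b.evalULift H).down Y
  | .inl a b => fun X Y =>
      retype (biprod.inl : _ ⟶ (a.evalULift H).down ⊞ (b.evalULift H).down) X Y
  | .inr a b => fun X Y =>
      retype (biprod.inr : _ ⟶ (a.evalULift H).down ⊞ (b.evalULift H).down) X Y
  | .fst a b => fun X Y =>
      retype (biprod.fst : (a.evalULift H).down ⊞ (b.evalULift H).down ⟶ _) X Y
  | .snd a b => fun X Y =>
      retype (biprod.snd : (a.evalULift H).down ⊞ (b.evalULift H).down ⟶ _) X Y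
  | .ker a b e => fun X Y =>
      retype (kernel.ι (e.eval H (a.evalULift H).down (b.evalULift H).down)) X Y
  | .coker a b e => fun X Y =>
      retype (cokernel.π (e.eval H (a.evalULift H).down (b.evalULift H).down)) X Y
  | .lift b e k => fun X Y =>
      factorRight (e.eval H Y (b.evalULift H).down) (k.eval H X (b.evalULift H).down)
  | .desc a e k => fun X Y =>
      factorLeft (e.eval H (a.evalULift H).down X) (k.eval H (a.evalULift H).down Y)

end

/-- The object of `B` that a term denotes, given a diagram of shape `Q` in `B`. -/
noncomputable def ObjTerm.eval (H : Q ⥤q B) (a : ObjTerm R Q) : B := (a.evalULift H).down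

variable (H : Q ⥤q B) (a b : ObjTerm R Q) (e k : MorTerm R Q)

lemma ObjTerm.isZero_eval_zero : IsZero (ObjTerm.eval H (.zero : ObjTerm R Q)) :=
  letI := HasZeroObject.zero' B
  isZero_zero B

namespace MorTerm

@[simp] lemma eval_gen {x y : Q} (f : x ⟶ y) : (gen f : MorTerm R Q).eval H
    (ObjTerm.eval H (.gen x : ObjTerm R Q)) (ObjTerm.eval H (.gen y : ObjTerm R Q)) = H.map f :=
  retype_self _

@[simp] lemma eval_id (X : B) : (id : MorTerm R Q).eval H X X = 𝟙 X := retype_self _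

@[simp] lemma eval_zero (X Y : B) : (zero : MorTerm R Q).eval H X Y = 0 := rfl

@[simp] lemma eval_add (X Y : B) : (add e k).eval H X Y = e.eval H X Y + k.eval H X Y := rfl

@[simp] lemma eval_smul (r : R) (X Y : B) : (smul r e).eval H X Y = r • e.eval H X Y := rfl

@[simp] lemma eval_comp (X Y : B) :
    (comp b e k).eval H X Y = e.eval H X (b.eval H) ≫ k.eval H (b.eval H) Y := rfl

@[simp] lemma eval_inl : (inl a b).eval H (a.eval H) ((ObjTerm.biprod a b).eval H) =
    (biprod.inl : a.eval H ⟶ a.eval H ⊞ b.eval H) := retype_self _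

@[simp] lemma eval_inr : (inr a b).eval H (b.eval H) ((ObjTerm.biprod a b).eval H) =
    (biprod.inr : b.eval H ⟶ a.eval H ⊞ b.eval H) := retype_self _

@[simp] lemma eval_fst : (fst a b).eval H ((ObjTerm.biprod a b).eval H) (a.eval H) =
    (biprod.fst : a.eval H ⊞ b.eval H ⟶ a.eval H) := retype_self _

@[simp] lemma eval_snd : (snd a b).eval H ((ObjTerm.biprod a b).eval H) (b.eval H) =
    (biprod.snd : a.eval H ⊞ b.eval H ⟶ b.eval H) := retype_self _

@[simp] lemma eval_ker : (ker a b e).eval H ((ObjTerm.ker a b e).eval H) (a.eval H) =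
    kernel.ι (e.eval H (a.eval H) (b.eval H)) := retype_self _

@[simp] lemma eval_coker : (coker a b e).eval H (b.eval H) ((ObjTerm.coker a b e).eval H) =
    cokernel.π (e.eval H (a.eval H) (b.eval H)) := retype_self _

lemma eval_lift_comp {X Y : B} (h : ∃ l, l ≫ e.eval H Y (b.eval H) = k.eval H X (b.eval H)) :
    (lift b e k).eval H X Y ≫ e.eval H Y (b.eval H) = k.eval H X (b.eval H) :=
  factorRight_comp h

lemma comp_eval_desc {X Y : B} (h : ∃ l, e.eval H (a.eval H) X ≫ l = k.eval H (a.eval H) Y) :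
    e.eval H (a.eval H) X ≫ (desc a e k).eval H X Y = k.eval H (a.eval H) Y :=
  comp_factorLeft h

end MorTerm

end Eval

/-- `WellTyped H a b e`: in view of the diagrams `H i`, the term `e` is a well-formed morphism
between the well-formed objects `a` and `b`. In particular `a` is well-formed if and only if
`WellTyped H a a .id`. -/
inductive WellTyped {R : Type w} [CommRing R] {Q : Type q} [Quiver.{p} Q] {ι : Type z}
    {B : ι → Type t} [∀ i, Category.{s} (B i)] [∀ i, Abelian (B i)] [∀ i, Linear R (B i)]
    (H : ∀ i, Q ⥤q B i) : ObjTerm R Q → ObjTerm R Q → MorTerm R Q → Prop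
  | id_gen (x : Q) : WellTyped H (.gen x) (.gen x) .id
  | id_zero : WellTyped H .zero .zero .id
  | id_biprod {a b} (ha : WellTyped H a a .id) (hb : WellTyped H b b .id) :
      WellTyped H (.biprod a b) (.biprod a b) .id
  | id_ker {a b e} (he : WellTyped H a b e) : WellTyped H (.ker a b e) (.ker a b e) .id
  | id_coker {a b e} (he : WellTyped H a b e) : WellTyped H (.coker a b e) (.coker a b e) .id
  | gen {x y : Q} (f : x ⟶ y) : WellTyped H (.gen x) (.gen y) (.gen f)
  | zero {a b} (ha : WellTyped H a a .id) (hb : WellTyped H b b .id) : WellTyped H a b .zero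
  | add {a b e k} (he : WellTyped H a b e) (hk : WellTyped H a b k) :
      WellTyped H a b (.add e k)
  | smul {a b e} (r : R) (he : WellTyped H a b e) : WellTyped H a b (.smul r e)
  | comp {a b c e k} (he : WellTyped H a b e) (hk : WellTyped H b c k) :
      WellTyped H a c (.comp b e k)
  | inl {a b} (ha : WellTyped H a a .id) (hb : WellTyped H b b .id) :
      WellTyped H a (.biprod a b) (.inl a b)
  | inr {a b} (ha : WellTyped H a a .id) (hb : WellTyped H b b .id) :
      WellTyped H b (.biprod a b) (.inr a b)
  | fst {a b} (ha : WellTyped H a a .id) (hb : WellTyped H b b .id) :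
      WellTyped H (.biprod a b) a (.fst a b)
  | snd {a b} (ha : WellTyped H a a .id) (hb : WellTyped H b b .id) :
      WellTyped H (.biprod a b) b (.snd a b)
  | ker {a b e} (he : WellTyped H a b e) : WellTyped H (.ker a b e) a (.ker a b e)
  | coker {a b e} (he : WellTyped H a b e) : WellTyped H b (.coker a b e) (.coker a b e)
  | lift {a b c e k} (he : WellTyped H a b e) (hk : WellTyped H c b k)
      (hmono : ∀ i, Mono (e.eval (H i) (a.eval (H i)) (b.eval (H i))))
      (hfac : ∀ i, ∃ l, l ≫ e.eval (H i) (a.eval (H i)) (b.eval (H i)) =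
        k.eval (H i) (c.eval (H i)) (b.eval (H i))) : WellTyped H c a (.lift b e k)
  | desc {a b c e k} (he : WellTyped H a b e) (hk : WellTyped H a c k)
      (hepi : ∀ i, Epi (e.eval (H i) (a.eval (H i)) (b.eval (H i))))
      (hfac : ∀ i, ∃ l, e.eval (H i) (a.eval (H i)) (b.eval (H i)) ≫ l =
        k.eval (H i) (a.eval (H i)) (c.eval (H i))) : WellTyped H b c (.desc a e k)

namespace WellTyped

variable {R : Type w} [CommRing R] {Q : Type q} [Quiver.{p} Q] {ι : Type z}
  {B : ι → Type t} [∀ i, Category.{s} (B i)] [∀ i, Abelian (B i)] [∀ i, Linear R (B i)]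
  {H : ∀ i, Q ⥤q B i} {a b : ObjTerm R Q} {e : MorTerm R Q}

lemma ends (h : WellTyped H a b e) : WellTyped H a a .id ∧ WellTyped H b b .id := by
  induction h with
  | id_gen x => exact ⟨.id_gen x, .id_gen x⟩
  | id_zero => exact ⟨.id_zero, .id_zero⟩
  | id_biprod ha hb => exact ⟨.id_biprod ha hb, .id_biprod ha hb⟩
  | id_ker he => exact ⟨.id_ker he, .id_ker he⟩
  | id_coker he => exact ⟨.id_coker he, .id_coker he⟩
  | gen f => exact ⟨.id_gen _, .id_gen _⟩
  | zero ha hb => exact ⟨ha, hb⟩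
  | add _ _ h _ => exact h
  | smul _ _ h => exact h
  | comp _ _ h h' => exact ⟨h.1, h'.2⟩
  | inl ha hb => exact ⟨ha, .id_biprod ha hb⟩
  | inr ha hb => exact ⟨hb, .id_biprod ha hb⟩
  | fst ha hb => exact ⟨.id_biprod ha hb, ha⟩
  | snd ha hb => exact ⟨.id_biprod ha hb, hb⟩
  | ker he h => exact ⟨.id_ker he, h.1⟩
  | coker he h => exact ⟨h.2, .id_coker he⟩
  | lift _ _ _ _ h h' => exact ⟨h'.1, h.1⟩
  | desc _ _ _ _ h h' => exact ⟨h.2, h'.2⟩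

lemma of_ker (h : WellTyped H (.ker a b e) (.ker a b e) .id) : WellTyped H a b e := by
  cases h; assumption

lemma of_coker (h : WellTyped H (.coker a b e) (.coker a b e) .id) : WellTyped H a b e := by
  cases h; assumption

lemma of_biprod (h : WellTyped H (.biprod a b) (.biprod a b) .id) :
    WellTyped H a a .id ∧ WellTyped H b b .id := by
  cases h; exact ⟨‹_›, ‹_›⟩

end WellTyped

/-! ### The abelian category of terms -/

section TermCategory

variable (R : Type w) [CommRing R] {Q : Type q} [Quiver.{p} Q] {ι : Type z}
  {B : ι → Type t} [∀ i, Category.{s} (B i)] [∀ i, Abelian (B i)] [∀ i, Linear R (B i)]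
  (H : ∀ i, Q ⥤q B i)

/-- The category whose objects are the well-formed object terms and whose morphisms are the
well-formed morphism terms, two of them being identified if they denote the same morphism for all
diagrams `H i`. -/
structure TermCat where
  /-- The underlying term. -/
  term : ObjTerm R Q
  wf : WellTyped H term term .id

variable {R H}

namespace TermCat

/-- Two well-formed morphism terms are equivalent if all diagrams give them the same value. -/
def homSetoid (a b : TermCat R H) : Setoid {e : MorTerm R Q // WellTyped H a.term b.term e} where
  r e k := ∀ i, e.1.eval (H i) (a.term.eval (H i)) (b.term.eval (H i)) =
    k.1.eval (H i) (a.term.eval (H i)) (b.term.eval (H i))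
  iseqv := ⟨fun _ _ => rfl, fun h i => (h i).symm, fun h h' i => (h i).trans (h' i)⟩

/-- Morphisms of `TermCat R H`. -/
def Hom (a b : TermCat R H) : Type _ := Quotient (homSetoid a b)

/-- The morphism given by a well-formed term. -/
def Hom.mk {a b : TermCat R H} (e : MorTerm R Q) (he : WellTyped H a.term b.term e) : Hom a b :=
  Quotient.mk (homSetoid a b) ⟨e, he⟩

lemma Hom.exists_rep {a b : TermCat R H} (f : Hom a b) : ∃ e he, f = Hom.mk e he := by
  obtain ⟨⟨e, he⟩, rfl⟩ := Quotient.exists_rep f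
  exact ⟨e, he, rfl⟩

/-- The value of a morphism for the diagram `H i`. -/
noncomputable def Hom.eval {a b : TermCat R H} (f : Hom a b) (i : ι) :
    a.term.eval (H i) ⟶ b.term.eval (H i) :=
  Quotient.lift (s := homSetoid a b)
    (fun e => e.1.eval (H i) (a.term.eval (H i)) (b.term.eval (H i))) (fun _ _ h => h i) f

lemma Hom.eval_mk {a b : TermCat R H} (e : MorTerm R Q) (he : WellTyped H a.term b.term e)
    (i : ι) : (Hom.mk e he : Hom a b).eval i =
      e.eval (H i) (a.term.eval (H i)) (b.term.eval (H i)) := rfl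

lemma Hom.eval_injective {a b : TermCat R H} :
    Function.Injective (Hom.eval : Hom a b → ∀ i, a.term.eval (H i) ⟶ b.term.eval (H i)) := by
  intro f g h
  obtain ⟨e, he, rfl⟩ := f.exists_rep
  obtain ⟨k, hk, rfl⟩ := g.exists_rep
  exact Quotient.sound (s := homSetoid a b) (fun i => congrFun h i)

/-- Composition of morphisms of `TermCat R H`. -/
def Hom.comp {a b c : TermCat R H} (f : Hom a b) (g : Hom b c) : Hom a c :=
  Quotient.map₂ (sa := homSetoid a b) (sb := homSetoid b c) (sc := homSetoid a c)
    (fun e k => ⟨.comp b.term e.1 k.1, .comp e.2 k.2⟩)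
    (fun _ _ h _ _ h' i => by simp [h i, h' i]) f g

lemma Hom.eval_comp {a b c : TermCat R H} (f : Hom a b) (g : Hom b c) (i : ι) :
    (f.comp g).eval i = f.eval i ≫ g.eval i := by
  obtain ⟨e, he, rfl⟩ := f.exists_rep
  obtain ⟨k, hk, rfl⟩ := g.exists_rep
  rfl

lemma Hom.eval_id {a : TermCat R H} (i : ι) : (Hom.mk .id a.wf : Hom a a).eval i = 𝟙 _ := by
  simp [Hom.eval_mk]

instance : Category (TermCat R H) where
  Hom := Hom
  id a := Hom.mk .id a.wf
  comp := Hom.comp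
  id_comp _ := Hom.eval_injective (by ext i; simp [Hom.eval_comp, Hom.eval_id])
  comp_id _ := Hom.eval_injective (by ext i; simp [Hom.eval_comp, Hom.eval_id])
  assoc _ _ _ := Hom.eval_injective (by ext i; simp [Hom.eval_comp])

/-- The morphism given by a well-formed term. -/
def mkHom {a b : TermCat R H} (e : MorTerm R Q) (he : WellTyped H a.term b.term e) : a ⟶ b :=
  Hom.mk e he

lemma exists_mkHom {a b : TermCat R H} (f : a ⟶ b) : ∃ e he, f = mkHom e he :=
  Hom.exists_rep f

variable (R H) in
/-- Evaluation of terms for the diagram `H i`, as a functor. -/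
noncomputable def evalFunctor (i : ι) : TermCat R H ⥤ B i where
  obj a := a.term.eval (H i)
  map f := Hom.eval f i
  map_id _ := Hom.eval_id i
  map_comp f g := Hom.eval_comp f g i

lemma hom_ext {a b : TermCat R H} {f g : a ⟶ b}
    (h : ∀ i, (evalFunctor R H i).map f = (evalFunctor R H i).map g) : f = g :=
  Hom.eval_injective (funext h)

lemma mono_of_eval {a b : TermCat R H} (f : a ⟶ b) (h : ∀ i, Mono ((evalFunctor R H i).map f)) :
    Mono f where
  right_cancellation u v huv := hom_ext fun i => by
    rw [← cancel_mono ((evalFunctor R H i).map f), ← Functor.map_comp, huv, Functor.map_comp]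

lemma epi_of_eval {a b : TermCat R H} (f : a ⟶ b) (h : ∀ i, Epi ((evalFunctor R H i).map f)) :
    Epi f where
  left_cancellation u v huv := hom_ext fun i => by
    rw [← cancel_epi ((evalFunctor R H i).map f), ← Functor.map_comp, huv, Functor.map_comp]

instance (a b : TermCat R H) : Zero (a ⟶ b) := ⟨mkHom .zero (.zero a.wf b.wf)⟩

instance (a b : TermCat R H) : SMul R (a ⟶ b) where
  smul r f := Quotient.map (sa := homSetoid a b) (sb := homSetoid a b)
    (fun e => ⟨.smul r e.1, .smul r e.2⟩) (fun _ _ h i => by simp [h i]) f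

instance (a b : TermCat R H) : Add (a ⟶ b) where
  add f g := Quotient.map₂ (sa := homSetoid a b) (sb := homSetoid a b) (sc := homSetoid a b)
    (fun e k => ⟨.add e.1 k.1, .add e.2 k.2⟩) (fun _ _ h _ _ h' i => by simp [h i, h' i]) f g

@[simp]
lemma map_zero' (i : ι) (a b : TermCat R H) : (evalFunctor R H i).map (0 : a ⟶ b) = 0 := rfl

@[simp]
lemma map_smul' (i : ι) {a b : TermCat R H} (r : R) (f : a ⟶ b) :
    (evalFunctor R H i).map (r • f) = r • (evalFunctor R H i).map f := by
  obtain ⟨e, he, rfl⟩ := exists_mkHom f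
  rfl

@[simp]
lemma map_add' (i : ι) {a b : TermCat R H} (f g : a ⟶ b) :
    (evalFunctor R H i).map (f + g) = (evalFunctor R H i).map f + (evalFunctor R H i).map g := by
  obtain ⟨e, he, rfl⟩ := exists_mkHom f
  obtain ⟨k, hk, rfl⟩ := exists_mkHom g
  rfl

instance (a b : TermCat R H) : Neg (a ⟶ b) := ⟨fun f => (-1 : R) • f⟩

instance (a b : TermCat R H) : AddCommGroup (a ⟶ b) where
  add_assoc _ _ _ := hom_ext fun i => by simp [add_assoc]
  zero_add _ := hom_ext fun i => by simp
  add_zero _ := hom_ext fun i => by simp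
  nsmul := nsmulRec
  zsmul := zsmulRec
  neg_add_cancel f := hom_ext fun i => by
    change (evalFunctor R H i).map ((-1 : R) • f + f) = _
    simp
  add_comm _ _ := hom_ext fun i => by simp [add_comm]

instance : Preadditive (TermCat R H) where
  add_comp _ _ _ _ _ _ := hom_ext fun i => by simp
  comp_add _ _ _ _ _ _ := hom_ext fun i => by simp

instance : Linear R (TermCat R H) where
  homModule a b :=
    { one_smul := fun _ => hom_ext fun i => by simp
      mul_smul := fun _ _ _ => hom_ext fun i => by simp [mul_smul]
      smul_zero := fun _ => hom_ext fun i => by simp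
      smul_add := fun _ _ _ => hom_ext fun i => by simp
      add_smul := fun _ _ _ => hom_ext fun i => by simp [add_smul]
      zero_smul := fun _ => hom_ext fun i => by simp }
  smul_comp _ _ _ _ _ _ := hom_ext fun i => by simp
  comp_smul _ _ _ _ _ _ := hom_ext fun i => by simp

instance (i : ι) : (evalFunctor R H i).Additive where
  map_add := map_add' i _ _

instance (i : ι) : (evalFunctor R H i).Linear R where
  map_smul f r := map_smul' i r f

/-- The zero object. -/
def zeroObj : TermCat R H := ⟨.zero, .id_zero⟩

lemma isZero_zeroObj : IsZero (zeroObj : TermCat R H) := by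
  rw [IsZero.iff_id_eq_zero]
  exact hom_ext fun i => (ObjTerm.isZero_eval_zero (R := R) (H i)).eq_of_src _ _

instance : HasZeroObject (TermCat R H) := ⟨_, isZero_zeroObj⟩

/-- The biproduct of two objects. -/
def biprodObj (a b : TermCat R H) : TermCat R H := ⟨.biprod a.term b.term, .id_biprod a.wf b.wf⟩

section

variable (a b : TermCat R H)

/-- The first inclusion. -/
def inl : a ⟶ a.biprodObj b := mkHom (.inl a.term b.term) (.inl a.wf b.wf)
/-- The second inclusion. -/
def inr : b ⟶ a.biprodObj b := mkHom (.inr a.term b.term) (.inr a.wf b.wf)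
/-- The first projection. -/
def fst : a.biprodObj b ⟶ a := mkHom (.fst a.term b.term) (.fst a.wf b.wf)
/-- The second projection. -/
def snd : a.biprodObj b ⟶ b := mkHom (.snd a.term b.term) (.snd a.wf b.wf)

variable (i : ι)

lemma map_inl : (evalFunctor R H i).map (inl a b) =
    (biprod.inl : a.term.eval (H i) ⟶ a.term.eval (H i) ⊞ b.term.eval (H i)) :=
  MorTerm.eval_inl _ _ _

lemma map_inr : (evalFunctor R H i).map (inr a b) =
    (biprod.inr : b.term.eval (H i) ⟶ a.term.eval (H i) ⊞ b.term.eval (H i)) :=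
  MorTerm.eval_inr _ _ _

lemma map_fst : (evalFunctor R H i).map (fst a b) =
    (biprod.fst : a.term.eval (H i) ⊞ b.term.eval (H i) ⟶ a.term.eval (H i)) :=
  MorTerm.eval_fst _ _ _

lemma map_snd : (evalFunctor R H i).map (snd a b) =
    (biprod.snd : a.term.eval (H i) ⊞ b.term.eval (H i) ⟶ b.term.eval (H i)) :=
  MorTerm.eval_snd _ _ _

@[simp]
lemma inl_fst : inl a b ≫ fst a b = 𝟙 a := hom_ext fun i => by
  rw [CategoryTheory.Functor.map_id, Functor.map_comp, map_inl, map_fst]; exact biprod.inl_fst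

@[simp]
lemma inl_snd : inl a b ≫ snd a b = 0 := hom_ext fun i => by
  rw [Functor.map_comp, map_inl, map_snd, Functor.map_zero]; exact biprod.inl_snd

@[simp]
lemma inr_fst : inr a b ≫ fst a b = 0 := hom_ext fun i => by
  rw [Functor.map_comp, map_inr, map_fst, Functor.map_zero]; exact biprod.inr_fst

@[simp]
lemma inr_snd : inr a b ≫ snd a b = 𝟙 b := hom_ext fun i => by
  rw [CategoryTheory.Functor.map_id, Functor.map_comp, map_inr, map_snd]; exact biprod.inr_snd

lemma total : fst a b ≫ inl a b + snd a b ≫ inr a b = 𝟙 (a.biprodObj b) := hom_ext fun i => by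
  rw [CategoryTheory.Functor.map_id, Functor.map_add, Functor.map_comp, Functor.map_comp,
    map_inl, map_inr, map_fst, map_snd]
  exact biprod.total

/-- The biproduct, as a bicone. -/
def bicone : BinaryBicone a b where
  pt := a.biprodObj b
  fst := fst a b
  snd := snd a b
  inl := inl a b
  inr := inr a b

instance : HasBinaryBiproduct a b :=
  hasBinaryBiproduct_of_total (bicone a b) (total a b)

end

instance : HasBinaryBiproducts (TermCat R H) := ⟨fun _ _ => inferInstance⟩

instance : HasFiniteProducts (TermCat R H) := hasFiniteProducts_of_has_binary_and_terminal

lemma map_comp_eq_zero {a b c : TermCat R H} {f : a ⟶ b} {g : b ⟶ c} (h : f ≫ g = 0) (i : ι) :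
    (evalFunctor R H i).map f ≫ (evalFunctor R H i).map g = 0 := by
  rw [← Functor.map_comp, h, Functor.map_zero]

/-- Factorization through a morphism that every diagram turns into a monomorphism. -/
lemma exists_comp_eq {a b c : TermCat R H} (f : a ⟶ b) (g : c ⟶ b)
    (hf : ∀ i, Mono ((evalFunctor R H i).map f))
    (hg : ∀ i, ∃ l, l ≫ (evalFunctor R H i).map f = (evalFunctor R H i).map g) :
    ∃ l : c ⟶ a, l ≫ f = g := by
  obtain ⟨e, he, rfl⟩ := exists_mkHom f
  obtain ⟨k, hk, rfl⟩ := exists_mkHom g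
  exact ⟨mkHom (.lift b.term e k) (.lift he hk hf hg),
    hom_ext fun i => MorTerm.eval_lift_comp _ _ _ _ (hg i)⟩

/-- Factorization through a morphism that every diagram turns into an epimorphism. -/
lemma exists_eq_comp {a b c : TermCat R H} (f : a ⟶ b) (g : a ⟶ c)
    (hf : ∀ i, Epi ((evalFunctor R H i).map f))
    (hg : ∀ i, ∃ l, (evalFunctor R H i).map f ≫ l = (evalFunctor R H i).map g) :
    ∃ l : b ⟶ c, f ≫ l = g := by
  obtain ⟨e, he, rfl⟩ := exists_mkHom f
  obtain ⟨k, hk, rfl⟩ := exists_mkHom g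
  exact ⟨mkHom (.desc a.term e k) (.desc he hk hf hg),
    hom_ext fun i => MorTerm.comp_eval_desc _ _ _ _ (hg i)⟩

section Kernels

variable {a b : TermCat R H} (e : MorTerm R Q) (he : WellTyped H a.term b.term e)

/-- The kernel of the morphism given by a term. -/
def kerObj : TermCat R H := ⟨.ker a.term b.term e, .id_ker he⟩

/-- The inclusion of the kernel. -/
def kerι : kerObj e he ⟶ a := mkHom (.ker a.term b.term e) (.ker he)

lemma map_kerι (i : ι) : (evalFunctor R H i).map (kerι e he) =
    kernel.ι ((evalFunctor R H i).map (mkHom e he)) := MorTerm.eval_ker _ _ _ _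

lemma kerι_comp : kerι e he ≫ mkHom e he = 0 := hom_ext fun i => by
  rw [Functor.map_comp, map_kerι]; exact kernel.condition _

lemma mono_map_kerι (i : ι) : Mono ((evalFunctor R H i).map (kerι e he)) := by
  rw [map_kerι]; exact inferInstanceAs (Mono (kernel.ι _))

lemma mono_kerι : Mono (kerι e he) := mono_of_eval _ (mono_map_kerι e he)

/-- `kerι` is a kernel. -/
noncomputable def isLimitKer : IsLimit (KernelFork.ofι (kerι e he) (kerι_comp e he)) :=
  haveI := mono_kerι e he
  have h {c : TermCat R H} (g : c ⟶ a) (hg : g ≫ mkHom e he = 0) : ∃ l, l ≫ kerι e he = g :=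
    exists_comp_eq _ _ (mono_map_kerι e he) fun i =>
      ⟨kernel.lift ((evalFunctor R H i).map (mkHom e he)) ((evalFunctor R H i).map g)
        (map_comp_eq_zero hg i),
        by rw [map_kerι]; exact kernel.lift_ι _ _ _⟩
  KernelFork.IsLimit.ofι' _ _ fun g hg => ⟨(h g hg).choose, (h g hg).choose_spec⟩

/-- Evaluation preserves the kernel `kerι`. -/
noncomputable def isLimitMapKer (i : ι) :
    IsLimit ((KernelFork.ofι (kerι e he) (kerι_comp e he)).map (evalFunctor R H i)) :=
  IsLimit.ofIsoLimit (kernelIsKernel ((evalFunctor R H i).map (mkHom e he)))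
    (Fork.ext (Iso.refl _) ((Category.id_comp _).trans (map_kerι e he i)))

/-- The cokernel of the morphism given by a term. -/
def cokerObj : TermCat R H := ⟨.coker a.term b.term e, .id_coker he⟩

/-- The projection to the cokernel. -/
def cokerπ : b ⟶ cokerObj e he := mkHom (.coker a.term b.term e) (.coker he)

lemma map_cokerπ (i : ι) : (evalFunctor R H i).map (cokerπ e he) =
    cokernel.π ((evalFunctor R H i).map (mkHom e he)) := MorTerm.eval_coker _ _ _ _

lemma comp_cokerπ : mkHom e he ≫ cokerπ e he = 0 := hom_ext fun i => by
  rw [Functor.map_comp, map_cokerπ]; exact cokernel.condition _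

lemma epi_map_cokerπ (i : ι) : Epi ((evalFunctor R H i).map (cokerπ e he)) := by
  rw [map_cokerπ]; exact inferInstanceAs (Epi (cokernel.π _))

lemma epi_cokerπ : Epi (cokerπ e he) := epi_of_eval _ (epi_map_cokerπ e he)

/-- `cokerπ` is a cokernel. -/
noncomputable def isColimitCoker :
    IsColimit (CokernelCofork.ofπ (cokerπ e he) (comp_cokerπ e he)) :=
  haveI := epi_cokerπ e he
  have h {c : TermCat R H} (g : b ⟶ c) (hg : mkHom e he ≫ g = 0) : ∃ l, cokerπ e he ≫ l = g :=
    exists_eq_comp _ _ (epi_map_cokerπ e he) fun i =>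
      ⟨cokernel.desc ((evalFunctor R H i).map (mkHom e he)) ((evalFunctor R H i).map g)
        (map_comp_eq_zero hg i),
        by rw [map_cokerπ]; exact cokernel.π_desc _ _ _⟩
  CokernelCofork.IsColimit.ofπ' _ _ fun g hg => ⟨(h g hg).choose, (h g hg).choose_spec⟩

/-- Evaluation preserves the cokernel `cokerπ`. -/
noncomputable def isColimitMapCoker (i : ι) :
    IsColimit ((CokernelCofork.ofπ (cokerπ e he) (comp_cokerπ e he)).map (evalFunctor R H i)) :=
  IsColimit.ofIsoColimit (cokernelIsCokernel ((evalFunctor R H i).map (mkHom e he)))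
    (Cofork.ext (Iso.refl _) ((Category.comp_id _).trans (map_cokerπ e he i).symm))

end Kernels

instance : HasKernels (TermCat R H) where
  has_limit f := by
    obtain ⟨e, he, rfl⟩ := exists_mkHom f
    exact ⟨⟨_, isLimitKer e he⟩⟩

instance : HasCokernels (TermCat R H) where
  has_colimit f := by
    obtain ⟨e, he, rfl⟩ := exists_mkHom f
    exact ⟨⟨_, isColimitCoker e he⟩⟩

lemma mono_map {a b : TermCat R H} (f : a ⟶ b) [Mono f] (i : ι) :
    Mono ((evalFunctor R H i).map f) := by
  obtain ⟨e, he, rfl⟩ := exists_mkHom f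
  apply Preadditive.mono_of_kernel_zero
  have h : kerι e he = 0 := by rw [← cancel_mono (mkHom e he), kerι_comp, zero_comp]
  rw [← map_kerι, h]
  rfl

lemma epi_map {a b : TermCat R H} (f : a ⟶ b) [Epi f] (i : ι) :
    Epi ((evalFunctor R H i).map f) := by
  obtain ⟨e, he, rfl⟩ := exists_mkHom f
  apply Preadditive.epi_of_cokernel_zero
  have h : cokerπ e he = 0 := by rw [← cancel_epi (mkHom e he), comp_cokerπ, comp_zero]
  rw [← map_cokerπ, h]
  rfl

instance : IsNormalMonoCategory (TermCat R H) where
  normalMonoOfMono {a b} f _ := by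
    obtain ⟨e, he, rfl⟩ := exists_mkHom f
    have h {c : TermCat R H} (g : c ⟶ b) (hg : g ≫ cokerπ e he = 0) : ∃ l, l ≫ mkHom e he = g :=
      exists_comp_eq _ _ (mono_map _) fun i =>
        haveI := mono_map (mkHom e he) i
        ⟨Abelian.monoLift ((evalFunctor R H i).map (mkHom e he)) ((evalFunctor R H i).map g)
          (by rw [← map_cokerπ]; exact map_comp_eq_zero hg i),
          Abelian.monoLift_comp _ _ _⟩
    exact ⟨⟨_, cokerπ e he, comp_cokerπ e he, KernelFork.IsLimit.ofι' _ _
      fun g hg => ⟨(h g hg).choose, (h g hg).choose_spec⟩⟩⟩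

instance : IsNormalEpiCategory (TermCat R H) where
  normalEpiOfEpi {a b} f _ := by
    obtain ⟨e, he, rfl⟩ := exists_mkHom f
    have h {c : TermCat R H} (g : a ⟶ c) (hg : kerι e he ≫ g = 0) : ∃ l, mkHom e he ≫ l = g :=
      exists_eq_comp _ _ (epi_map _) fun i =>
        haveI := epi_map (mkHom e he) i
        ⟨Abelian.epiDesc ((evalFunctor R H i).map (mkHom e he)) ((evalFunctor R H i).map g)
          (by rw [← map_kerι]; exact map_comp_eq_zero hg i),
          Abelian.comp_epiDesc _ _ _⟩
    exact ⟨⟨_, kerι e he, kerι_comp e he, CokernelCofork.IsColimit.ofπ' _ _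
      fun g hg => ⟨(h g hg).choose, (h g hg).choose_spec⟩⟩⟩

instance : Abelian (TermCat R H) where

lemma preservesLimit_eval (i : ι) {a b : TermCat R H} (f : a ⟶ b) :
    PreservesLimit (parallelPair f 0) (evalFunctor R H i) := by
  obtain ⟨e, he, rfl⟩ := exists_mkHom f
  exact preservesLimit_of_preserves_limit_cone (isLimitKer e he)
    ((KernelFork.isLimitMapConeEquiv _ _).symm (isLimitMapKer e he i))

lemma preservesColimit_eval (i : ι) {a b : TermCat R H} (f : a ⟶ b) :
    PreservesColimit (parallelPair f 0) (evalFunctor R H i) := by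
  obtain ⟨e, he, rfl⟩ := exists_mkHom f
  exact preservesColimit_of_preserves_colimit_cocone (isColimitCoker e he)
    ((CokernelCofork.isColimitMapCoconeEquiv _ _).symm (isColimitMapCoker e he i))

instance (i : ι) : PreservesFiniteLimits (evalFunctor R H i) :=
  have : ∀ {a b : TermCat R H} (f : a ⟶ b),
    PreservesLimit (parallelPair f 0) (evalFunctor R H i) := preservesLimit_eval i
  Functor.preservesFiniteLimits_of_preservesKernels _

instance (i : ι) : PreservesFiniteColimits (evalFunctor R H i) :=
  have : ∀ {a b : TermCat R H} (f : a ⟶ b),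
    PreservesColimit (parallelPair f 0) (evalFunctor R H i) := preservesColimit_eval i
  Functor.preservesFiniteColimits_of_preservesCokernels _

end TermCat

end TermCategory

/-! ### Extension of natural transformations from the generators -/

namespace TermCat

variable {R : Type w} [CommRing R] {Q : Type q} [Quiver.{p} Q] {ι : Type z}
  {B : ι → Type t} [∀ i, Category.{s} (B i)] [∀ i, Abelian (B i)] [∀ i, Linear R (B i)]
  {H : ∀ i, Q ⥤q B i}

variable (R H) in
/-- The generating diagram in the category of terms. -/
def generators : Q ⥤q TermCat R H where
  obj x := ⟨.gen x, .id_gen x⟩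
  map f := mkHom (.gen f) (.gen f)

@[simp]
lemma evalFunctor_map_generators (i : ι) {x y : Q} (f : x ⟶ y) :
    (evalFunctor R H i).map ((generators R H).map f) = (H i).map f :=
  MorTerm.eval_gen _ _

variable {D : Type t'} [Category.{s'} D] [Abelian D] {F G : TermCat R H ⥤ D}

/-- The components of the extension to all terms of a family of morphisms between the values of
two functors at the generators. -/
noncomputable def extendApp
    (α : ∀ x : Q, F.obj ((generators R H).obj x) ⟶ G.obj ((generators R H).obj x)) :
    ∀ (o : ObjTerm R Q) (h : WellTyped H o o .id), F.obj ⟨o, h⟩ ⟶ G.obj ⟨o, h⟩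
  | .gen x, _ => α x
  | .zero, _ => 0
  | .biprod a b, h =>
      F.map (fst ⟨a, h.of_biprod.1⟩ ⟨b, h.of_biprod.2⟩) ≫ extendApp α a _ ≫ G.map (inl _ _) +
        F.map (snd ⟨a, h.of_biprod.1⟩ ⟨b, h.of_biprod.2⟩) ≫ extendApp α b _ ≫ G.map (inr _ _)
  | .ker a b e, h =>
      factorRight (G.map (kerι (a := ⟨a, h.of_ker.ends.1⟩) (b := ⟨b, h.of_ker.ends.2⟩) e h.of_ker))
        (F.map (kerι (a := ⟨a, h.of_ker.ends.1⟩) (b := ⟨b, h.of_ker.ends.2⟩) e h.of_ker) ≫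
          extendApp α a _)
  | .coker a b e, h =>
      factorLeft
        (F.map (cokerπ (a := ⟨a, h.of_coker.ends.1⟩) (b := ⟨b, h.of_coker.ends.2⟩) e h.of_coker))
        (extendApp α b _ ≫
          G.map (cokerπ (a := ⟨a, h.of_coker.ends.1⟩) (b := ⟨b, h.of_coker.ends.2⟩) e h.of_coker))

lemma exists_comp_map_kerι [G.Additive] [PreservesFiniteLimits G] {a b : TermCat R H}
    {e : MorTerm R Q} (he : WellTyped H a.term b.term e) {X : D} (k : X ⟶ G.obj a)
    (hk : k ≫ G.map (mkHom e he : a ⟶ b) = 0) : ∃ l, l ≫ G.map (kerι e he) = k :=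
  ⟨_, (KernelFork.IsLimit.lift' (KernelFork.mapIsLimit _ (isLimitKer e he) G) k hk).2⟩

lemma exists_map_cokerπ_comp [F.Additive] [PreservesFiniteColimits F] {a b : TermCat R H}
    {e : MorTerm R Q} (he : WellTyped H a.term b.term e) {X : D} (k : F.obj b ⟶ X)
    (hk : F.map (mkHom e he : a ⟶ b) ≫ k = 0) : ∃ l, F.map (cokerπ e he) ≫ l = k :=
  ⟨_, (CokernelCofork.IsColimit.desc' (CokernelCofork.mapIsColimit _ (isColimitCoker e he) F) k
    hk).2⟩

section

variable [F.Additive] [PreservesFiniteLimits G] [PreservesFiniteColimits F]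

/-- Natural transformations between exact functors are determined by their values at the
generators. -/
lemma natTrans_ext {φ ψ : F ⟶ G}
    (h : ∀ x, φ.app ((generators R H).obj x) = ψ.app ((generators R H).obj x)) : φ = ψ := by
  have key {a b : ObjTerm R Q} {e : MorTerm R Q} (he : WellTyped H a b e) :
      φ.app ⟨a, he.ends.1⟩ = ψ.app ⟨a, he.ends.1⟩ ∧
        φ.app ⟨b, he.ends.2⟩ = ψ.app ⟨b, he.ends.2⟩ := by
    have hker {a b e} (he : WellTyped H a b e)
        (h : φ.app ⟨a, he.ends.1⟩ = ψ.app ⟨a, he.ends.1⟩) :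
        φ.app ⟨_, .id_ker he⟩ = ψ.app ⟨_, .id_ker he⟩ := by
      let f := kerι (a := ⟨a, he.ends.1⟩) (b := ⟨b, he.ends.2⟩) e he
      have : Mono f := mono_kerι _ _
      change φ.app (kerObj (a := ⟨a, he.ends.1⟩) (b := ⟨b, he.ends.2⟩) e he) = ψ.app _
      rw [← cancel_mono (G.map f), ← φ.naturality, ← ψ.naturality, h]
    have hcoker {a b e} (he : WellTyped H a b e)
        (h : φ.app ⟨b, he.ends.2⟩ = ψ.app ⟨b, he.ends.2⟩) :
        φ.app ⟨_, .id_coker he⟩ = ψ.app ⟨_, .id_coker he⟩ := by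
      let f := cokerπ (a := ⟨a, he.ends.1⟩) (b := ⟨b, he.ends.2⟩) e he
      have : Epi f := epi_cokerπ _ _
      change φ.app (cokerObj (a := ⟨a, he.ends.1⟩) (b := ⟨b, he.ends.2⟩) e he) = ψ.app _
      rw [← cancel_epi (F.map f), φ.naturality, ψ.naturality, h]
    have hbiprod {a b} (ha : WellTyped H a a .id) (hb : WellTyped H b b .id)
        (h : φ.app ⟨a, ha⟩ = ψ.app ⟨a, ha⟩) (h' : φ.app ⟨b, hb⟩ = ψ.app ⟨b, hb⟩) :
        φ.app ⟨_, .id_biprod ha hb⟩ = ψ.app ⟨_, .id_biprod ha hb⟩ := by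
      change φ.app (biprodObj ⟨a, ha⟩ ⟨b, hb⟩) = ψ.app (biprodObj ⟨a, ha⟩ ⟨b, hb⟩)
      rw [← Category.id_comp (φ.app _), ← Category.id_comp (ψ.app _), ← F.map_id, ← total,
        F.map_add, F.map_comp, F.map_comp, Preadditive.add_comp, Preadditive.add_comp]
      simp only [Category.assoc, φ.naturality, ψ.naturality, h, h']
    induction he with
    | id_gen x => exact ⟨h x, h x⟩
    | id_zero =>
      have h0 : IsZero (F.obj (zeroObj : TermCat R H)) := F.map_isZero isZero_zeroObj
      exact ⟨h0.eq_of_src _ _, h0.eq_of_src _ _⟩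
    | id_biprod ha hb h h' => exact ⟨hbiprod ha hb h.1 h'.1, hbiprod ha hb h.1 h'.1⟩
    | id_ker he h => exact ⟨hker he h.1, hker he h.1⟩
    | id_coker he h => exact ⟨hcoker he h.2, hcoker he h.2⟩
    | gen f => exact ⟨h _, h _⟩
    | zero ha hb h h' => exact ⟨h.1, h'.1⟩
    | add _ _ h _ => exact h
    | smul _ _ h => exact h
    | comp _ _ h h' => exact ⟨h.1, h'.2⟩
    | inl ha hb h h' => exact ⟨h.1, hbiprod ha hb h.1 h'.1⟩
    | inr ha hb h h' => exact ⟨h'.1, hbiprod ha hb h.1 h'.1⟩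
    | fst ha hb h h' => exact ⟨hbiprod ha hb h.1 h'.1, h.1⟩
    | snd ha hb h h' => exact ⟨hbiprod ha hb h.1 h'.1, h'.1⟩
    | ker he h => exact ⟨hker he h.1, h.1⟩
    | coker he h => exact ⟨h.2, hcoker he h.2⟩
    | lift _ _ _ _ h h' => exact ⟨h'.1, h.1⟩
    | desc _ _ _ _ h h' => exact ⟨h.2, h'.2⟩
  ext a
  exact (key a.wf).1

variable [G.Additive] [Linear R D] [F.Linear R] [G.Linear R]

lemma extendApp_naturality
    (α : ∀ x : Q, F.obj ((generators R H).obj x) ⟶ G.obj ((generators R H).obj x))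
    (hα : ∀ {x y : Q} (f : x ⟶ y), F.map ((generators R H).map f) ≫ α y =
      α x ≫ G.map ((generators R H).map f))
    {a b : ObjTerm R Q} {e : MorTerm R Q} (h : WellTyped H a b e) :
    F.map (mkHom e h : (⟨a, h.ends.1⟩ : TermCat R H) ⟶ ⟨b, h.ends.2⟩) ≫ extendApp α b h.ends.2 =
      extendApp α a h.ends.1 ≫ G.map (mkHom e h) := by
  have hid (a : TermCat R H) : F.map (mkHom .id a.wf : a ⟶ a) ≫ extendApp α a.term a.wf =
      extendApp α a.term a.wf ≫ G.map (mkHom .id a.wf) := by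
    change F.map (𝟙 a) ≫ _ = _ ≫ G.map (𝟙 a)
    simp
  induction h with
  | id_gen x => exact hid ⟨_, .id_gen x⟩
  | id_zero => exact hid ⟨_, .id_zero⟩
  | id_biprod ha hb => exact hid ⟨_, .id_biprod ha hb⟩
  | id_ker he => exact hid ⟨_, .id_ker he⟩
  | id_coker he => exact hid ⟨_, .id_coker he⟩
  | gen f => exact hα f
  | @zero a b ha hb =>
    change F.map (0 : (⟨a, ha⟩ : TermCat R H) ⟶ ⟨b, hb⟩) ≫ _ = _ ≫ G.map 0
    simp
  | @add a b e k he hk h h' =>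
    change F.map ((mkHom e he : (⟨a, he.ends.1⟩ : TermCat R H) ⟶ ⟨b, he.ends.2⟩) + mkHom k hk) ≫ _ =
      _ ≫ G.map (mkHom e he + mkHom k hk)
    rw [F.map_add, G.map_add, Preadditive.add_comp, Preadditive.comp_add, h, h']
  | @smul a b e r he h =>
    change F.map (r • (mkHom e he : (⟨a, he.ends.1⟩ : TermCat R H) ⟶ ⟨b, he.ends.2⟩)) ≫ _ =
      _ ≫ G.map (r • mkHom e he)
    rw [F.map_smul, G.map_smul, Linear.smul_comp, Linear.comp_smul, h]
  | @comp a b c e k he hk h h' =>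
    let f : (⟨a, he.ends.1⟩ : TermCat R H) ⟶ ⟨b, he.ends.2⟩ := mkHom e he
    let g : (⟨b, hk.ends.1⟩ : TermCat R H) ⟶ ⟨c, hk.ends.2⟩ := mkHom k hk
    change F.map (f ≫ g) ≫ _ = _ ≫ G.map (f ≫ g)
    rw [F.map_comp, G.map_comp, Category.assoc, h', ← Category.assoc, h, Category.assoc]
  | @inl a b ha hb =>
    change F.map (inl ⟨a, ha⟩ ⟨b, hb⟩) ≫ (_ + _) = _ ≫ G.map (inl ⟨a, ha⟩ ⟨b, hb⟩)
    rw [Preadditive.comp_add, ← F.map_comp_assoc, ← F.map_comp_assoc]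
    simp
  | @inr a b ha hb =>
    change F.map (inr ⟨a, ha⟩ ⟨b, hb⟩) ≫ (_ + _) = _ ≫ G.map (inr ⟨a, ha⟩ ⟨b, hb⟩)
    rw [Preadditive.comp_add, ← F.map_comp_assoc, ← F.map_comp_assoc]
    simp
  | @fst a b ha hb =>
    change F.map (fst ⟨a, ha⟩ ⟨b, hb⟩) ≫ _ = (_ + _) ≫ G.map (fst ⟨a, ha⟩ ⟨b, hb⟩)
    simp only [Preadditive.add_comp, Category.assoc, ← G.map_comp]
    simp
  | @snd a b ha hb =>
    change F.map (snd ⟨a, ha⟩ ⟨b, hb⟩) ≫ _ = (_ + _) ≫ G.map (snd ⟨a, ha⟩ ⟨b, hb⟩)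
    simp only [Preadditive.add_comp, Category.assoc, ← G.map_comp]
    simp
  | @ker a b e he h =>
    refine (factorRight_comp (exists_comp_map_kerι (a := ⟨a, he.ends.1⟩) (b := ⟨b, he.ends.2⟩)
      he _ ?_)).symm
    have hz : F.map (kerι (a := ⟨a, he.ends.1⟩) (b := ⟨b, he.ends.2⟩) e he) ≫
        F.map (mkHom (b := ⟨b, he.ends.2⟩) e he) = 0 := by rw [← F.map_comp, kerι_comp, F.map_zero]
    rw [Category.assoc, ← h]
    exact (Category.assoc _ _ _).symm.trans ((congrArg (· ≫ extendApp α b _) hz).trans zero_comp)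
  | @coker a b e he h =>
    refine comp_factorLeft (exists_map_cokerπ_comp (a := ⟨a, he.ends.1⟩) (b := ⟨b, he.ends.2⟩)
      he _ ?_)
    have hz : G.map (mkHom (a := ⟨a, he.ends.1⟩) e he) ≫
        G.map (cokerπ (a := ⟨a, he.ends.1⟩) (b := ⟨b, he.ends.2⟩) e he) = 0 := by
      rw [← G.map_comp, comp_cokerπ, G.map_zero]
    rw [← Category.assoc, h]
    exact (Category.assoc _ _ _).trans ((congrArg (extendApp α a _ ≫ ·) hz).trans comp_zero)
  | @lift a b c e k he hk hmono hfac h h' =>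
    let f : (⟨a, he.ends.1⟩ : TermCat R H) ⟶ ⟨b, he.ends.2⟩ := mkHom e he
    let l : (⟨c, hk.ends.1⟩ : TermCat R H) ⟶ ⟨a, he.ends.1⟩ :=
      mkHom (.lift b e k) (.lift he hk hmono hfac)
    have hl : l ≫ f = mkHom k hk := hom_ext fun i => MorTerm.eval_lift_comp _ _ _ _ (hfac i)
    have : Mono f := mono_of_eval _ hmono
    change F.map l ≫ _ = _ ≫ G.map l
    rw [← cancel_mono (G.map f), Category.assoc, Category.assoc, ← h, ← G.map_comp, hl, ← h',
      ← hl, F.map_comp, Category.assoc]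
  | @desc a b c e k he hk hepi hfac h h' =>
    let f : (⟨a, he.ends.1⟩ : TermCat R H) ⟶ ⟨b, he.ends.2⟩ := mkHom e he
    let l : (⟨b, he.ends.2⟩ : TermCat R H) ⟶ ⟨c, hk.ends.2⟩ :=
      mkHom (.desc a e k) (.desc he hk hepi hfac)
    have hl : f ≫ l = mkHom k hk := hom_ext fun i => MorTerm.comp_eval_desc _ _ _ _ (hfac i)
    have : Epi f := epi_of_eval _ hepi
    change F.map l ≫ _ = _ ≫ G.map l
    rw [← cancel_epi (F.map f), ← Category.assoc, ← Category.assoc, h, ← F.map_comp, hl, h',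
      ← hl, G.map_comp, Category.assoc]

/-- A family of morphisms between the values of two exact linear functors at the generators that
is natural for the generating arrows extends to a natural transformation. -/
noncomputable def extend
    (α : ∀ x : Q, F.obj ((generators R H).obj x) ⟶ G.obj ((generators R H).obj x))
    (hα : ∀ {x y : Q} (f : x ⟶ y), F.map ((generators R H).map f) ≫ α y =
      α x ≫ G.map ((generators R H).map f)) : F ⟶ G where
  app a := extendApp α a.term a.wf
  naturality _ _ f := by
    obtain ⟨e, he, rfl⟩ := exists_mkHom f
    exact extendApp_naturality α hα he

end

/-- The diagrams `H i` jointly detect exactness. -/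
lemma exactAt_of_eval {a b c : TermCat R H} {f : a ⟶ b} {g : b ⟶ c}
    (h : ∀ i, ExactAt ((evalFunctor R H i).map f) ((evalFunctor R H i).map g)) : ExactAt f g := by
  have w : f ≫ g = 0 := hom_ext fun i => by
    rw [Functor.map_comp, (h i).choose, Functor.map_zero]
  refine ⟨w, ?_⟩
  rw [ShortComplex.exact_iff_isZero_homology, IsZero.iff_id_eq_zero]
  refine hom_ext fun i => IsZero.eq_of_src ?_ _ _
  obtain ⟨w', hi⟩ := h i
  exact IsZero.of_iso ((ShortComplex.exact_iff_isZero_homology _).1 hi)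
    ((ShortComplex.mk f g w).mapHomologyIso (evalFunctor R H i)).symm

end TermCat

lemma isExactLinear_comp {R : Type w} [CommRing R] {A : Type a} [Category.{b} A] [Abelian A]
    [Linear R A] {B : Type u} [Category.{v} B] [Abelian B] [Linear R B]
    {D : Type t} [Category.{s} D] [Abelian D] [Linear R D] {F : A ⥤ B} {G : B ⥤ D}
    (hF : isExactLinear R A B F) (hG : isExactLinear R B D G) : isExactLinear R A D (F ⋙ G) := by
  obtain ⟨_, _, _, _⟩ := hF
  obtain ⟨_, _, _, _⟩ := hG
  exact ⟨inferInstance, inferInstance, comp_preservesFiniteLimits _ _,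
    comp_preservesFiniteColimits _ _⟩

lemma TermCat.isExactLinear_evalFunctor {R : Type w} [CommRing R] {Q : Type u} [Quiver.{v} Q]
    {ι : Type z} {B : ι → Type t} [∀ i, Category.{s} (B i)] [∀ i, Abelian (B i)]
    [∀ i, Linear R (B i)] (H : ∀ i, Q ⥤q B i) (i : ι) :
    isExactLinear R (TermCat R H) (B i) (evalFunctor R H i) :=
  ⟨inferInstance, inferInstance, inferInstance, inferInstance⟩

/-! ### The universal cohomology -/

/-- The vertices of the diagram underlying a cohomology. -/
structure CohVertex (C : Type u) where
  obj : C
  deg : ℕ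

/-- The arrows of the diagram underlying a cohomology. -/
inductive CohArrow {C : Type u} [Category.{v} C] : CohVertex C → CohVertex C → Type (max u v)
  | res {X Y : C} (n : ℕ) (f : X ⟶ Y) : CohArrow ⟨Y, n⟩ ⟨X, n⟩

instance (C : Type u) [Category.{v} C] : Quiver.{max u v} (CohVertex C) := ⟨CohArrow⟩

namespace Cohomology

variable {C : Type u} [Category.{v} C] {A : Type a} [Category.{b} A]

/-- The diagram underlying a cohomology. -/
def diagram (K : Cohomology C A) : CohVertex C ⥤q A where
  obj x := (K x.deg).obj (op x.obj)
  map
    | .res n f => (K n).map f.op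

section Family

variable (R : Type w) [CommRing R] {ι : Type z} {B : ι → Type t} [∀ i, Category.{s} (B i)]
  [∀ i, Abelian (B i)] [∀ i, Linear R (B i)] (K : ∀ i, Cohomology C (B i))

/-- The category of terms of a family of cohomologies. -/
abbrev Terms := TermCat R (fun i => (K i).diagram)

/-- The morphism of the category of terms given by a morphism of `C`. -/
def res (n : ℕ) {X Y : C} (f : X ⟶ Y) :
    (TermCat.generators R (fun i => (K i).diagram)).obj ⟨Y, n⟩ ⟶
      (TermCat.generators R (fun i => (K i).diagram)).obj ⟨X, n⟩ :=
  (TermCat.generators R (fun i => (K i).diagram)).map (CohArrow.res n f)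

lemma map_res (i : ι) (n : ℕ) {X Y : C} (f : X ⟶ Y) :
    (TermCat.evalFunctor R (fun i => (K i).diagram) i).map (res R K n f) = (K i n).map f.op :=
  TermCat.evalFunctor_map_generators _ _

/-- The cohomology with values in the category of terms of a family of cohomologies. -/
def generic : Cohomology C (Terms R K) := fun n =>
  { obj := fun X => (TermCat.generators R _).obj ⟨X.unop, n⟩
    map := fun f => res R K n f.unop
    map_id := fun X => TermCat.hom_ext fun i => by
      rw [map_res, CategoryTheory.Functor.map_id]
      exact (K i n).map_id X
    map_comp := fun f g => TermCat.hom_ext fun i => by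
      rw [Functor.map_comp, map_res, map_res, map_res]
      exact (K i n).map_comp f g }

variable (D : Type a) [Category.{b} D] [Abelian D] [Linear R D]

instance faithful_pushforwardFunctor_generic :
    ((generic R K).pushforwardFunctor R D).Faithful where
  map_injective {F G} φ ψ h := by
    obtain ⟨_, _, _, _⟩ := F.property
    obtain ⟨_, _, _, _⟩ := G.property
    ext1
    exact TermCat.natTrans_ext fun x => congrArg (fun θ => (θ x.deg).app (op x.obj)) h

instance full_pushforwardFunctor_generic :
    ((generic R K).pushforwardFunctor R D).Full where
  map_surjective {F G} θ := by
    obtain ⟨_, _, _, _⟩ := F.property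
    obtain ⟨_, _, _, _⟩ := G.property
    refine ⟨ObjectProperty.homMk (TermCat.extend (fun x => (θ x.deg).app (op x.obj)) ?_), ?_⟩
    · rintro _ _ (⟨n, f⟩)
      exact (θ n).naturality f.op
    · rfl

/-- Every member of the family is a push-forward of the generic cohomology. -/
noncomputable def genericIso (i : ι) :
    (generic R K).pushforward (TermCat.evalFunctor R (fun i => (K i).diagram) i) ≅ K i :=
  let e (n : ℕ) : generic R K n ⋙ TermCat.evalFunctor R (fun i => (K i).diagram) i ≅ K i n :=
    NatIso.ofComponents (fun _ => Iso.refl _) fun f =>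
      (Category.comp_id _).trans ((map_res R K i n f.unop).trans (Category.id_comp _).symm)
  { hom := fun n => (e n).hom
    inv := fun n => (e n).inv
    hom_inv_id := funext fun n => (e n).hom_inv_id
    inv_hom_id := funext fun n => (e n).inv_hom_id }

end Family

/-- Push-forward of isomorphisms of cohomologies. -/
def pushforwardIso {B : Type t} [Category.{s} B] {K L : Cohomology C A} (e : K ≅ L) (G : A ⥤ B) :
    K.pushforward G ≅ L.pushforward G where
  hom := fun n => Functor.whiskerRight (e.hom n) G
  inv := fun n => Functor.whiskerRight (e.inv n) G
  hom_inv_id := funext fun n => by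
    refine (Functor.whiskerRight_comp _ _ _).symm.trans ?_
    exact (congrArg (Functor.whiskerRight · G) (congrFun e.hom_inv_id n)).trans
      (Functor.whiskerRight_id' _)
  inv_hom_id := funext fun n => by
    refine (Functor.whiskerRight_comp _ _ _).symm.trans ?_
    exact (congrArg (Functor.whiskerRight · G) (congrFun e.inv_hom_id n)).trans
      (Functor.whiskerRight_id' _)

end Cohomology

/-- A cohomology on `C` with values in an `R`-linear abelian category in the universe of the
category of terms. -/
structure SmallCohomology (R : Type w) [CommRing R] (C : Type u) [Category.{v} C] where
  /-- The category of values. -/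
  carrier : Type (max u v w)
  [category : Category.{max u v w} carrier]
  [abelian : Abelian carrier]
  [linear : Linear R carrier]
  /-- The cohomology. -/
  cohomology : Cohomology C carrier

attribute [instance] SmallCohomology.category SmallCohomology.abelian SmallCohomology.linear

namespace Cohomology

variable (R : Type w) [CommRing R] (C : Type u) [Category.{v} C]

/-- The universal cohomology, constructed from all cohomologies with values in small categories. -/
def universal : Cohomology C (Terms R fun X : SmallCohomology.{w, u, v} R C => X.cohomology) :=
  generic R _

/-- A cohomology with values in a large category `B` factors through the small category of terms
that it generates. -/
theorem isUniversal_universal :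
    Cohomology.IsUniversal.{w, u, v, max u v w, max u v w, t, s} R (universal R C) := by
  intro B _ _ _
  have : ((universal R C).pushforwardFunctor R B).EssSurj := by
    refine ⟨fun L => ?_⟩
    let X : SmallCohomology.{w, u, v} R C := ⟨_, generic R (fun _ : PUnit.{1} => L)⟩
    let F := TermCat.evalFunctor R
      (fun X : SmallCohomology.{w, u, v} R C => X.cohomology.diagram) X
    let G := TermCat.evalFunctor R (fun _ : PUnit.{1} => L.diagram) ⟨⟩
    exact ⟨⟨F ⋙ G, isExactLinear_comp (TermCat.isExactLinear_evalFunctor _ _)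
      (TermCat.isExactLinear_evalFunctor _ _)⟩,
      ⟨pushforwardIso (genericIso R (fun X : SmallCohomology.{w, u, v} R C => X.cohomology) X) G ≪≫
        genericIso R (fun _ : PUnit.{1} => L) ⟨⟩⟩⟩
  have : ((universal R C).pushforwardFunctor R B).Faithful :=
    faithful_pushforwardFunctor_generic R _ B
  have : ((universal R C).pushforwardFunctor R B).Full := full_pushforwardFunctor_generic R _ B
  exact { }

variable {C}

/-- Cohomologies are the same as functors on `Cᵒᵖ × ℕ`. -/
def toFunctorFunctor (B : Type t) [Category.{s} B] :
    Cohomology C B ⥤ (Cᵒᵖ × Discrete ℕ ⥤ B) :=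
  (piEquivalenceFunctorDiscrete ℕ (Cᵒᵖ ⥤ B)).functor ⋙ Functor.uncurry ⋙
    (Functor.whiskeringLeft _ _ _).obj (CategoryTheory.Prod.swap Cᵒᵖ (Discrete ℕ))

instance (B : Type t) [Category.{s} B] : (toFunctorFunctor (C := C) B).IsEquivalence :=
  have : (Functor.uncurry (C := Discrete ℕ) (D := Cᵒᵖ) (E := B)).IsEquivalence :=
    inferInstanceAs (Functor.currying).functor.IsEquivalence
  have : ((Functor.whiskeringLeft _ _ B).obj
      (CategoryTheory.Prod.swap Cᵒᵖ (Discrete ℕ))).IsEquivalence := inferInstance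
  inferInstanceAs (_ ⋙ _ ⋙ _).IsEquivalence

theorem IsUniversal.isFreeAbelian {R : Type w} [CommRing R] {A : Type a} [Category.{b} A]
    [Abelian A] [Linear R A] {U : Cohomology C A}
    (hU : Cohomology.IsUniversal.{w, u, v, a, b, t, s} R U) :
    IsFreeAbelian.{w, u, v, a, b, t, s} R U.toFunctor := by
  intro B _ _ _
  have := hU B
  have e : U.pushforwardFunctor R B ⋙ toFunctorFunctor B ≅ restrictAlong R U.toFunctor B :=
    NatIso.ofComponents
      (fun G => NatIso.ofComponents (fun _ => Iso.refl _) (by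
        rintro ⟨X, ⟨n⟩⟩ ⟨Y, ⟨m⟩⟩ ⟨f, ⟨⟨h⟩⟩⟩
        obtain rfl : n = m := h
        simp only [toFunctorFunctor, toFunctor, restrictAlong, pushforwardFunctor]
        simp
        exact (Category.comp_id _).trans (Category.id_comp _).symm))
      (fun φ => by
        ext ⟨X, ⟨n⟩⟩
        exact (Category.comp_id _).trans (Category.id_comp _).symm)
  exact Functor.isEquivalence_of_iso e

end Cohomology

/-! ### The universal relative cohomology -/

/-- The vertices of the diagram underlying a relative cohomology. -/
structure RelVertex {C : Type u} [Category.{v} C] (M : MorphismProperty C) where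
  pair : Pairs M
  deg : ℕ

/-- The arrows of the diagram underlying a relative cohomology: those induced by morphisms of
pairs, and the boundaries. -/
inductive RelArrow {C : Type u} [Category.{v} C] {M : MorphismProperty C} :
    RelVertex M → RelVertex M → Type (max u v)
  | res {p q : Pairs M} (n : ℕ) (f : p ⟶ q) : RelArrow ⟨q, n⟩ ⟨p, n⟩
  | boundary (n : ℕ) (T : PairTriple M) : RelArrow ⟨T.pairYZ, n⟩ ⟨T.pairXY, n + 1⟩

instance {C : Type u} [Category.{v} C] (M : MorphismProperty C) :
    Quiver.{max u v} (RelVertex M) := ⟨RelArrow⟩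

namespace RelCohomology

variable {C : Type u} [Category.{v} C] {M : MorphismProperty C} [M.IsStableUnderComposition]
  {A : Type a} [Category.{b} A] [Abelian A]

/-- The diagram underlying a relative cohomology. -/
def diagram (K : RelCohomology M A) : RelVertex M ⥤q A where
  obj x := (K.H x.deg).obj (op x.pair)
  map
    | .res n f => (K.H n).map f.op
    | .boundary n T => K.δ n T

/-- An isomorphism of relative cohomologies from isomorphisms of the functors. -/
def isoMk {K L : RelCohomology M A} (e : ∀ n, K.H n ≅ L.H n)
    (comm : ∀ (n : ℕ) (T : PairTriple M), (e n).hom.app (op T.pairYZ) ≫ L.δ n T =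
      K.δ n T ≫ (e (n + 1)).hom.app (op T.pairXY)) : K ≅ L where
  hom := { app := fun n => (e n).hom, comm := comm }
  inv :=
    { app := fun n => (e n).inv
      comm := fun n T => by
        rw [← cancel_mono ((e (n + 1)).hom.app (op T.pairXY)), Category.assoc, ← comm,
          Category.assoc, Iso.inv_hom_id_app, Category.comp_id, Iso.inv_hom_id_app_assoc] }
  hom_inv_id := Hom.ext (funext fun n => (e n).hom_inv_id)
  inv_hom_id := Hom.ext (funext fun n => (e n).inv_hom_id)

section Family

variable (R : Type w) [CommRing R] {ι : Type z} {B : ι → Type t} [∀ i, Category.{s} (B i)]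
  [∀ i, Abelian (B i)] [∀ i, Linear R (B i)] (K : ∀ i, RelCohomology M (B i))

/-- The category of terms of a family of relative cohomologies. -/
abbrev Terms := TermCat R (fun i => (K i).diagram)

/-- The morphism of the category of terms given by a morphism of pairs. -/
def res (n : ℕ) {p q : Pairs M} (f : p ⟶ q) :
    (TermCat.generators R (fun i => (K i).diagram)).obj ⟨q, n⟩ ⟶
      (TermCat.generators R (fun i => (K i).diagram)).obj ⟨p, n⟩ :=
  (TermCat.generators R (fun i => (K i).diagram)).map (RelArrow.res n f)

/-- The morphism of the category of terms given by a boundary. -/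
def boundary (n : ℕ) (T : PairTriple M) :
    (TermCat.generators R (fun i => (K i).diagram)).obj ⟨T.pairYZ, n⟩ ⟶
      (TermCat.generators R (fun i => (K i).diagram)).obj ⟨T.pairXY, n + 1⟩ :=
  (TermCat.generators R (fun i => (K i).diagram)).map (RelArrow.boundary n T)

lemma map_res (i : ι) (n : ℕ) {p q : Pairs M} (f : p ⟶ q) :
    (TermCat.evalFunctor R (fun i => (K i).diagram) i).map (res R K n f) = ((K i).H n).map f.op :=
  TermCat.evalFunctor_map_generators _ _

lemma map_boundary (i : ι) (n : ℕ) (T : PairTriple M) :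
    (TermCat.evalFunctor R (fun i => (K i).diagram) i).map (boundary R K n T) = (K i).δ n T :=
  TermCat.evalFunctor_map_generators _ _

/-- The relative cohomology with values in the category of terms of a family of relative
cohomologies. -/
def generic : RelCohomology M (Terms R K) where
  H n :=
    { obj := fun X => (TermCat.generators R _).obj ⟨X.unop, n⟩
      map := fun f => res R K n f.unop
      map_id := fun X => TermCat.hom_ext fun i => by
        rw [map_res, CategoryTheory.Functor.map_id]
        exact ((K i).H n).map_id X
      map_comp := fun f g => TermCat.hom_ext fun i => by
        rw [Functor.map_comp, map_res, map_res, map_res]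
        exact ((K i).H n).map_comp f g }
  δ n T := boundary R K n T
  naturality n T T' φ := TermCat.hom_ext fun i => by
    rw [Functor.map_comp, Functor.map_comp]
    erw [map_res, map_res, map_boundary, map_boundary]
    exact (K i).naturality n φ
  mono_zero T := TermCat.mono_of_eval _ fun i => by
    erw [map_res]
    exact (K i).mono_zero T
  exact_xz n T := TermCat.exactAt_of_eval fun i => by
    erw [map_res, map_res]
    exact (K i).exact_xz n T
  exact_yz n T := TermCat.exactAt_of_eval fun i => by
    erw [map_res, map_boundary]
    exact (K i).exact_yz n T
  exact_xy n T := TermCat.exactAt_of_eval fun i => by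
    erw [map_res, map_boundary]
    exact (K i).exact_xy n T

variable (D : Type a) [Category.{b} D] [Abelian D] [Linear R D]

instance faithful_pushforwardFunctor_generic :
    ((generic R K).pushforwardFunctor R D).Faithful where
  map_injective {F G} φ ψ h := by
    obtain ⟨_, _, _, _⟩ := F.property
    obtain ⟨_, _, _, _⟩ := G.property
    ext1
    exact TermCat.natTrans_ext fun x => congrArg (fun θ => (θ.app x.deg).app (op x.pair)) h

instance full_pushforwardFunctor_generic :
    ((generic R K).pushforwardFunctor R D).Full where
  map_surjective {F G} θ := by
    obtain ⟨_, _, _, _⟩ := F.property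
    obtain ⟨_, _, _, _⟩ := G.property
    refine ⟨ObjectProperty.homMk
      (TermCat.extend (fun x => (θ.app x.deg).app (op x.pair)) ?_), ?_⟩
    · rintro _ _ (⟨n, f⟩ | ⟨n, T⟩)
      · exact (θ.app n).naturality f.op
      · exact (θ.comm n T).symm
    · rfl

/-- Every member of the family is a push-forward of the generic relative cohomology. -/
noncomputable def genericIso (i : ι) :
    (generic R K).pushforward (TermCat.evalFunctor R (fun i => (K i).diagram) i) ≅ K i :=
  isoMk
    (fun n => NatIso.ofComponents (fun _ => Iso.refl _) fun f =>
      (Category.comp_id _).trans ((map_res R K i n f.unop).trans (Category.id_comp _).symm))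
    (fun n T => (Category.id_comp _).trans
      ((map_boundary R K i n T).symm.trans (Category.comp_id _).symm))

end Family

/-- Push-forward of isomorphisms of relative cohomologies. -/
def pushforwardIso {B : Type t} [Category.{s} B] [Abelian B] {K L : RelCohomology M A} (e : K ≅ L)
    (G : A ⥤ B) [G.Additive] [PreservesFiniteLimits G] [PreservesFiniteColimits G] :
    K.pushforward G ≅ L.pushforward G :=
  isoMk
    (fun n => Functor.isoWhiskerRight
      { hom := e.hom.app n
        inv := e.inv.app n
        hom_inv_id := congrArg (fun θ => Hom.app θ n) e.hom_inv_id
        inv_hom_id := congrArg (fun θ => Hom.app θ n) e.inv_hom_id } G)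
    (fun n T => (G.map_comp _ _).symm.trans
      ((congrArg G.map (e.hom.comm n T)).trans (G.map_comp _ _)))

end RelCohomology

/-- A relative cohomology with values in an `R`-linear abelian category in the universe of the
category of terms. -/
structure SmallRelCohomology (R : Type w) [CommRing R] {C : Type u} [Category.{v} C]
    (M : MorphismProperty C) [M.IsStableUnderComposition] where
  /-- The category of values. -/
  carrier : Type (max u v w)
  [category : Category.{max u v w} carrier]
  [abelian : Abelian carrier]
  [linear : Linear R carrier]
  /-- The relative cohomology. -/
  cohomology : RelCohomology M carrier

attribute [instance] SmallRelCohomology.category SmallRelCohomology.abelian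
  SmallRelCohomology.linear

namespace RelCohomology

variable (R : Type w) [CommRing R] {C : Type u} [Category.{v} C] (M : MorphismProperty C)
  [M.IsStableUnderComposition]

/-- The universal relative cohomology, constructed from all relative cohomologies with values in
small categories. -/
def universal :
    RelCohomology M (Terms R fun X : SmallRelCohomology.{w, u, v} R M => X.cohomology) :=
  generic R _

/-- A relative cohomology with values in a large category `B` factors through the small category
of terms that it generates. -/
theorem isUniversal_universal :
    RelCohomology.IsUniversal.{w, u, v, max u v w, max u v w, t, s} R (universal R M) := by
  intro B _ _ _
  have : ((universal R M).pushforwardFunctor R B).EssSurj := by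
    refine ⟨fun L => ?_⟩
    let X : SmallRelCohomology.{w, u, v} R M := ⟨_, generic R (fun _ : PUnit.{1} => L)⟩
    let F := TermCat.evalFunctor R
      (fun X : SmallRelCohomology.{w, u, v} R M => X.cohomology.diagram) X
    let G := TermCat.evalFunctor R (fun _ : PUnit.{1} => L.diagram) ⟨⟩
    exact ⟨⟨F ⋙ G, isExactLinear_comp (TermCat.isExactLinear_evalFunctor _ _)
      (TermCat.isExactLinear_evalFunctor _ _)⟩,
      ⟨pushforwardIso (genericIso R (fun X : SmallRelCohomology.{w, u, v} R M => X.cohomology) X)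
        G ≪≫ genericIso R (fun _ : PUnit.{1} => L) ⟨⟩⟩⟩
  have : ((universal R M).pushforwardFunctor R B).Faithful :=
    faithful_pushforwardFunctor_generic R _ B
  have : ((universal R M).pushforwardFunctor R B).Full := full_pushforwardFunctor_generic R _ B
  exact { }

end RelCohomology

theorem theorem1p1 (R : Type w) [CommRing R] (C : Type u) [Category.{v} C] :
    (∃ (A : Type (max u v w)) (_ : Category.{max u v w} A) (_ : Abelian A) (_ : Linear R A)
        (U : Cohomology C A),
      -- universality, tested on categories in arbitrary universes and in the universes of `A`
      (Cohomology.IsUniversal.{w, u, v, max u v w, max u v w, t, s} R U ∧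
        Cohomology.IsUniversal.{w, u, v, max u v w, max u v w, max u v w, max u v w} R U) ∧
      (IsFreeAbelian.{w, u, v, max u v w, max u v w, t, s} R U.toFunctor ∧
        IsFreeAbelian.{w, u, v, max u v w, max u v w, max u v w, max u v w} R
          U.toFunctor)) ∧
    (∀ (M : MorphismProperty C) [M.IsStableUnderComposition],
      ∃ (A : Type (max u v w)) (_ : Category.{max u v w} A) (_ : Abelian A) (_ : Linear R A)
        (U : RelCohomology M A),
      RelCohomology.IsUniversal.{w, u, v, max u v w, max u v w, t, s} R U ∧
      RelCohomology.IsUniversal.{w, u, v, max u v w, max u v w, max u v w, max u v w} R U) :=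
  ⟨⟨_, inferInstance, inferInstance, inferInstance, Cohomology.universal R C,
    ⟨Cohomology.isUniversal_universal R C, Cohomology.isUniversal_universal R C⟩,
    (Cohomology.isUniversal_universal R C).isFreeAbelian,
    (Cohomology.isUniversal_universal R C).isFreeAbelian⟩,
  fun M _ => ⟨_, inferInstance, inferInstance, inferInstance, RelCohomology.universal R M,
    RelCohomology.isUniversal_universal R M, RelCohomology.isUniversal_universal R M⟩⟩
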